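/- Let $n\ge 0$ be an integer, let $\mathbb{R}^n_+=(0,\infty)^n$ with the Euclidean norm $\|x\|$, and let $\mu\in\mathbb{R}^n$ be such that no $\mu_i$ is a negative integer (for instance $\mu\in[-1/2,\infty)^n$). For a multi-index $k\in\mathbb{N}_0^n$ put $|k|=k_1+\dots+k_n$, $T_i=x_i^{-1}\,\partial/\partial x_i$ and $T^k=T_n^{k_n}\circ\cdots\circ T_1^{k_1}$, and write $x^{-\mu-1/2}=\prod_i x_i^{-\mu_i-1/2}$. Let $\mathcal{H}_\mu$ be the space of all complex-valued $\phi\in C^\infty(\mathbb{R}^n_+)$ such that for all $m\in\mathbb{N}_0$ and $k\in\mathbb{N}_0^n$ $$\gamma^\mu_{m,k}(\phi)=\sup_{x\in\mathbb{R}^n_+}\bigl|(1+\|x\|^2)^m\,T^k\{x^{-\mu-1/2}\phi(x)\}\bigr|<\infty,$$ with the locally convex topology generated by the seminorms $\gamma^\mu_{m,k}$, and let $\mathcal{H}'_\mu$ be the space of continuous linear functionals on $\mathcal{H}_\mu$. For $k\in\mathbb{N}_0^n$ let $T^k\delta_\mu\in\mathcal{H}'_\mu$ be given by $$(T^k\delta_\mu,\phi)=C_\mu\lim_{x\to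 0,\;x\in\mathbb{R}^n_+}T^k\{x^{-\mu-1/2}\phi(x)\},\qquad C_\mu=\prod_{i=1}^n 2^{\mu_i}\Gamma(\mu_i+1)$$ (the limit exists for every $\phi\in\mathcal{H}_\mu$). Theorem. Let $f\in\mathcal{H}'_\mu$ satisfy $(f,\phi)=0$ for every $\phi\in\mathcal{H}_\mu$ for which there is a real $a>0$ with $\operatorname{supp}\phi\subset\{x\in\mathbb{R}^n_+:\|x\|\ge a\}$, where the support is taken relative to $\mathbb{R}^n_+$. Then there exist $N\in\mathbb{N}_0$ and scalars $c_k\in\mathbb{C}$, $|k|\le N$, such that $$f=\sum_{|k|\le N}c_k\,T^k\delta_\mu .$$ -/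

import Mathlib

open Filter Topology
open scoped ContDiff

noncomputable section

namespace Zemanian

/-- The open orthant `(0, ∞)ⁿ` inside `ℝⁿ` with the Euclidean norm. -/
def orthant (n : ℕ) : Set (EuclideanSpace ℝ (Fin n)) := {x | ∀ i, 0 < x i}

theorem isOpen_orthant (n : ℕ) : IsOpen (orthant n) := by
  have : orthant n = ⋂ i, {x : EuclideanSpace ℝ (Fin n) | 0 < x i} := by
    ext x; simp [orthant]
  rw [this]
  exact isOpen_iInter_of_finite fun i => isOpen_lt continuous_const (by fun_prop)

theorem convex_orthant (n : ℕ) : Convex ℝ (orthant n) := by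
  have : orthant n = ⋂ i, {x : EuclideanSpace ℝ (Fin n) | 0 < x i} := by
    ext x; simp [orthant]
  rw [this]
  refine convex_iInter fun i => ?_
  exact (convex_Ioi (0 : ℝ)).linear_preimage
    (EuclideanSpace.proj i : EuclideanSpace ℝ (Fin n) →L[ℝ] ℝ).toLinearMap

theorem orthant_nonempty (n : ℕ) : (orthant n).Nonempty :=
  ⟨WithLp.toLp 2 fun _ => 1, fun _ => by simp⟩

theorem smul_one_mem (n : ℕ) {t : ℝ} (ht : 0 < t) :
    (t • WithLp.toLp 2 (fun _ => (1 : ℝ)) : EuclideanSpace ℝ (Fin n)) ∈ orthant n :=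
  fun _ => by simpa using ht

instance nhdsWithin_orthant_neBot (n : ℕ) :
    (𝓝[orthant n] (0 : EuclideanSpace ℝ (Fin n))).NeBot := by
  rw [← mem_closure_iff_nhdsWithin_neBot]
  have h : Tendsto (fun t : ℝ => (t • WithLp.toLp 2 (fun _ => (1 : ℝ)) :
      EuclideanSpace ℝ (Fin n))) (𝓝[>] 0) (𝓝 0) := by
    have : Continuous (fun t : ℝ => (t • WithLp.toLp 2 (fun _ => (1 : ℝ)) :
      EuclideanSpace ℝ (Fin n))) := by fun_prop
    have h2 := this.tendsto 0
    rw [zero_smul] at h2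
    exact h2.mono_left nhdsWithin_le_nhds
  refine mem_closure_of_tendsto h ?_
  filter_upwards [self_mem_nhdsWithin] with t ht
  exact smul_one_mem n ht

/-- The space `C^∞((0, ∞)ⁿ)` of smooth complex-valued functions on the open orthant. A function on
the orthant is represented by its extension by zero to `ℝⁿ`. -/
def SmoothFun (n : ℕ) : Submodule ℂ (EuclideanSpace ℝ (Fin n) → ℂ) where
  carrier := {g | ContDiffOn ℝ ∞ g (orthant n) ∧ ∀ x ∉ orthant n, g x = 0}
  add_mem' := by
    rintro g h ⟨hg, hg0⟩ ⟨hh, hh0⟩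
    exact ⟨hg.add hh, fun x hx => by simp [hg0 x hx, hh0 x hx]⟩
  zero_mem' := ⟨contDiffOn_const, fun _ _ => rfl⟩
  smul_mem' := by
    rintro c g ⟨hg, hg0⟩
    exact ⟨hg.const_smul c, fun x hx => by simp [hg0 x hx]⟩

theorem SmoothFun.differentiableAt {n : ℕ} (g : SmoothFun n) {x : EuclideanSpace ℝ (Fin n)}
    (hx : x ∈ orthant n) : DifferentiableAt ℝ g.1 x :=
  (g.2.1.contDiffAt ((isOpen_orthant n).mem_nhds hx)).differentiableAt (by simp)

theorem SmoothFun.ext_on {n : ℕ} {g h : SmoothFun n} (H : ∀ x ∈ orthant n, g.1 x = h.1 x) :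
    g = h := by
  apply Subtype.ext
  funext x
  by_cases hx : x ∈ orthant n
  · exact H x hx
  · rw [g.2.2 x hx, h.2.2 x hx]

/-- The partial derivative `∂g/∂xᵢ` at `x`. -/
def partialDeriv {n : ℕ} (i : Fin n) (g : EuclideanSpace ℝ (Fin n) → ℂ)
    (x : EuclideanSpace ℝ (Fin n)) : ℂ :=
  fderiv ℝ g x (EuclideanSpace.single i 1)

theorem contDiffOn_partialDeriv {n : ℕ} (i : Fin n) (g : SmoothFun n) :
    ContDiffOn ℝ ∞ (partialDeriv i g.1) (orthant n) := by
  have h : ContDiffOn ℝ ∞ (fderiv ℝ g.1) (orthant n) :=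
    g.2.1.fderiv_of_isOpen (isOpen_orthant n) (by simp)
  exact h.clm_apply contDiffOn_const

theorem contDiffOn_inv_coord {n : ℕ} (i : Fin n) :
    ContDiffOn ℝ ∞ (fun x : EuclideanSpace ℝ (Fin n) => (((x i)⁻¹ : ℝ) : ℂ)) (orthant n) := by
  have h1 : ContDiffOn ℝ ∞ (fun x : EuclideanSpace ℝ (Fin n) => x i) (orthant n) :=
    (EuclideanSpace.proj i : EuclideanSpace ℝ (Fin n) →L[ℝ] ℝ).contDiff.contDiffOn
  have h : ContDiffOn ℝ ∞ (fun x : EuclideanSpace ℝ (Fin n) => (x i)⁻¹) (orthant n) :=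
    h1.inv fun x hx => (hx i).ne'
  exact Complex.ofRealCLM.contDiff.comp_contDiffOn h

/-- The operator `Tᵢ = xᵢ⁻¹ ∂/∂xᵢ` on `C^∞((0, ∞)ⁿ)`. -/
def T {n : ℕ} (i : Fin n) : Module.End ℂ (SmoothFun n) where
  toFun g := ⟨(orthant n).indicator fun x => (((x i)⁻¹ : ℝ) : ℂ) * partialDeriv i g.1 x,
    ((contDiffOn_inv_coord i).mul (contDiffOn_partialDeriv i g)).congr
      fun _ hx => Set.indicator_of_mem hx _,
    fun _ hx => Set.indicator_of_notMem hx _⟩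
  map_add' g h := by
    refine SmoothFun.ext_on fun x hx => ?_
    have : fderiv ℝ (g.1 + h.1) x = fderiv ℝ g.1 x + fderiv ℝ h.1 x :=
      fderiv_add (SmoothFun.differentiableAt g hx) (SmoothFun.differentiableAt h hx)
    simp [Set.indicator_of_mem hx, partialDeriv, this, mul_add]
  map_smul' c g := by
    refine SmoothFun.ext_on fun x hx => ?_
    have : fderiv ℝ (c • g.1) x = c • fderiv ℝ g.1 x :=
      fderiv_const_smul (SmoothFun.differentiableAt g hx) c
    simp [Set.indicator_of_mem hx, partialDeriv, this]
    ring

theorem T_apply {n : ℕ} (i : Fin n) (g : SmoothFun n) {x : EuclideanSpace ℝ (Fin n)}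
    (hx : x ∈ orthant n) : (T i g).1 x = (((x i)⁻¹ : ℝ) : ℂ) * partialDeriv i g.1 x :=
  Set.indicator_of_mem hx fun x => (((x i)⁻¹ : ℝ) : ℂ) * partialDeriv i g.1 x

/-- The operator `T^k = Tₙ^{kₙ} ∘ ⋯ ∘ T₁^{k₁}` for a multi-index `k`. -/
def Tpow {n : ℕ} (k : Fin n → ℕ) : Module.End ℂ (SmoothFun n) :=
  ((List.finRange n).map fun i => T i ^ k i).reverse.prod

/-- The monomial `x^ν = x₁^{ν₁} ⋯ xₙ^{νₙ}` with real exponents, for `x` in the orthant. -/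
def monomial {n : ℕ} (ν : Fin n → ℝ) (x : EuclideanSpace ℝ (Fin n)) : ℝ := ∏ i, x i ^ ν i

theorem contDiffOn_monomial {n : ℕ} (ν : Fin n → ℝ) :
    ContDiffOn ℝ ∞ (fun x : EuclideanSpace ℝ (Fin n) => ((monomial ν x : ℝ) : ℂ))
      (orthant n) := by
  have h : ContDiffOn ℝ ∞ (monomial ν) (orthant n) := by
    unfold monomial
    refine contDiffOn_prod fun i _ => ?_
    have h1 : ContDiffOn ℝ ∞ (fun x : EuclideanSpace ℝ (Fin n) => x i) (orthant n) :=
      (EuclideanSpace.proj i : EuclideanSpace ℝ (Fin n) →L[ℝ] ℝ).contDiff.contDiffOn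
    exact h1.rpow_const_of_ne fun x hx => (hx i).ne'
  exact Complex.ofRealCLM.contDiff.comp_contDiffOn h

/-- The operator `φ ↦ x^{-μ-1/2} φ(x)` on `C^∞((0, ∞)ⁿ)`. -/
def weightMul {n : ℕ} (μ : Fin n → ℝ) : Module.End ℂ (SmoothFun n) where
  toFun g := ⟨fun x => (monomial (fun i => -μ i - 1 / 2) x : ℂ) * g.1 x,
    (contDiffOn_monomial _).mul g.2.1, fun x hx => by simp [g.2.2 x hx]⟩
  map_add' g h := Subtype.ext (funext fun x => by simp [mul_add])
  map_smul' c g := Subtype.ext (funext fun x => by simp; ring)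

/-- The function `x ↦ (1 + ‖x‖²)^m |T^k{x^{-μ-1/2} φ(x)}|` on the orthant. -/
def weighted {n : ℕ} (μ : Fin n → ℝ) (m : ℕ) (k : Fin n → ℕ) (φ : SmoothFun n)
    (x : orthant n) : ℝ :=
  (1 + ‖x.1‖ ^ 2) ^ m * ‖(Tpow k (weightMul μ φ)).1 x.1‖

theorem weighted_nonneg {n : ℕ} (μ : Fin n → ℝ) (m : ℕ) (k : Fin n → ℕ) (φ : SmoothFun n)
    (x : orthant n) : 0 ≤ weighted μ m k φ x := by
  unfold weighted; positivity

theorem weighted_add_le {n : ℕ} (μ : Fin n → ℝ) (m : ℕ) (k : Fin n → ℕ) (φ ψ : SmoothFun n)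
    (x : orthant n) : weighted μ m k (φ + ψ) x ≤ weighted μ m k φ x + weighted μ m k ψ x := by
  unfold weighted
  rw [map_add, map_add, ← mul_add]
  gcongr
  exact norm_add_le _ _

theorem weighted_smul {n : ℕ} (μ : Fin n → ℝ) (m : ℕ) (k : Fin n → ℕ) (c : ℂ) (φ : SmoothFun n)
    (x : orthant n) : weighted μ m k (c • φ) x = ‖c‖ * weighted μ m k φ x := by
  unfold weighted
  rw [map_smul, map_smul]
  simp
  ring

/-- The Zemanian space `H_μ` of all `φ ∈ C^∞((0, ∞)ⁿ)` such that
`(1 + ‖x‖²)^m T^k{x^{-μ-1/2} φ(x)}` is bounded on the orthant for all `m` and `k`. -/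
def H {n : ℕ} (μ : Fin n → ℝ) : Submodule ℂ (SmoothFun n) where
  carrier := {φ | ∀ m k, BddAbove (Set.range (weighted μ m k φ))}
  add_mem' := by
    intro φ ψ hφ hψ m k
    obtain ⟨A, hA⟩ := hφ m k
    obtain ⟨B, hB⟩ := hψ m k
    refine ⟨A + B, ?_⟩
    rintro _ ⟨x, rfl⟩
    exact (weighted_add_le μ m k φ ψ x).trans (add_le_add (hA ⟨x, rfl⟩) (hB ⟨x, rfl⟩))
  zero_mem' := by
    intro m k
    refine ⟨0, ?_⟩
    rintro _ ⟨x, rfl⟩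
    simp [weighted]
  smul_mem' := by
    intro c φ hφ m k
    obtain ⟨A, hA⟩ := hφ m k
    refine ⟨‖c‖ * A, ?_⟩
    rintro _ ⟨x, rfl⟩
    rw [weighted_smul]
    exact mul_le_mul_of_nonneg_left (hA ⟨x, rfl⟩) (norm_nonneg _)

instance orthant_subtype_nonempty (n : ℕ) : Nonempty (orthant n) := (orthant_nonempty n).to_subtype

/-- The seminorm `γ_{m,k}^μ(φ) = sup_x (1 + ‖x‖²)^m |T^k{x^{-μ-1/2} φ(x)}|` on `H_μ`. -/
def gamma {n : ℕ} (μ : Fin n → ℝ) (m : ℕ) (k : Fin n → ℕ) : Seminorm ℂ (H μ) :=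
  Seminorm.of (fun φ => ⨆ x : orthant n, weighted μ m k φ.1 x)
    (fun φ ψ => ciSup_le fun x => (weighted_add_le μ m k φ.1 ψ.1 x).trans
      (add_le_add (le_ciSup (φ.2 m k) x) (le_ciSup (ψ.2 m k) x)))
    (fun c φ => by
      rw [Real.mul_iSup_of_nonneg (norm_nonneg c)]
      exact iSup_congr fun x => weighted_smul μ m k c φ.1 x)

/-- The family of all seminorms `γ_{m,k}^μ`. -/
def gammaFamily {n : ℕ} (μ : Fin n → ℝ) : SeminormFamily ℂ (H μ) (ℕ × (Fin n → ℕ)) :=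
  fun p => gamma μ p.1 p.2

/-- The topology of `H_μ`: the locally convex topology generated by the seminorms `γ_{m,k}^μ`
(it takes precedence over the topology of pointwise convergence). -/
instance (priority := high) instTopologicalSpaceH {n : ℕ} (μ : Fin n → ℝ) : TopologicalSpace (H μ) :=
  (gammaFamily μ).moduleFilterBasis.topology

theorem withSeminorms_H {n : ℕ} (μ : Fin n → ℝ) : WithSeminorms (gammaFamily μ) := ⟨rfl⟩

/-- The dual space `H'_μ` of continuous linear functionals on `H_μ`. -/
abbrev Dual {n : ℕ} (μ : Fin n → ℝ) : Type := H μ →L[ℂ] ℂ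

/-- The support of `φ`, that is, the closure of `{φ ≠ 0}` relative to the orthant. -/
def supp {n : ℕ} {μ : Fin n → ℝ} (φ : H μ) : Set (EuclideanSpace ℝ (Fin n)) :=
  closure (Function.support φ.1.1) ∩ orthant n

/-! The limit defining `T^k δ_μ` exists: the operators `Tᵢ` commute, so the gradient of
`T^k{x^{-μ-1/2} φ(x)}` is bounded near the origin. -/

theorem partialDeriv_inv_coord {n : ℕ} {i j : Fin n} (hij : i ≠ j) {x : EuclideanSpace ℝ (Fin n)}
    (hx : x ∈ orthant n) :
    partialDeriv i (fun x : EuclideanSpace ℝ (Fin n) => (((x j)⁻¹ : ℝ) : ℂ)) x = 0 := by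
  have hd : DifferentiableAt ℝ (fun x : EuclideanSpace ℝ (Fin n) => (((x j)⁻¹ : ℝ) : ℂ)) x :=
    ((contDiffOn_inv_coord j).contDiffAt ((isOpen_orthant n).mem_nhds hx)).differentiableAt
      (by simp)
  rw [partialDeriv, ← hd.lineDeriv_eq_fderiv]
  simp [lineDeriv, hij.symm]

theorem partialDeriv_T {n : ℕ} {i j : Fin n} (hij : i ≠ j) (g : SmoothFun n)
    {x : EuclideanSpace ℝ (Fin n)} (hx : x ∈ orthant n) :
    partialDeriv i (T j g).1 x
      = (((x j)⁻¹ : ℝ) : ℂ) * fderiv ℝ (fderiv ℝ g.1) x (EuclideanSpace.single i 1)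
          (EuclideanSpace.single j 1) := by
  have hnh := (isOpen_orthant n).mem_nhds hx
  have he : (T j g).1 =ᶠ[𝓝 x] fun x => (((x j)⁻¹ : ℝ) : ℂ) * partialDeriv j g.1 x :=
    Filter.eventually_of_mem hnh fun y hy => T_apply j g hy
  have hd1 : DifferentiableAt ℝ (fun x : EuclideanSpace ℝ (Fin n) => (((x j)⁻¹ : ℝ) : ℂ)) x :=
    ((contDiffOn_inv_coord j).contDiffAt hnh).differentiableAt (by simp)
  have hd2 : DifferentiableAt ℝ (partialDeriv j g.1) x :=
    ((contDiffOn_partialDeriv j g).contDiffAt hnh).differentiableAt (by simp)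
  have hd3 : DifferentiableAt ℝ (fderiv ℝ g.1) x :=
    ((g.2.1.fderiv_of_isOpen (isOpen_orthant n) (m := ∞) (by simp)).contDiffAt
      hnh).differentiableAt (by simp)
  have h0 := partialDeriv_inv_coord hij hx
  rw [partialDeriv] at h0
  rw [partialDeriv, he.fderiv_eq, fderiv_fun_mul hd1 hd2]
  have h2 : fderiv ℝ (partialDeriv j g.1) x (EuclideanSpace.single i 1)
      = fderiv ℝ (fderiv ℝ g.1) x (EuclideanSpace.single i 1) (EuclideanSpace.single j 1) := by
    have : partialDeriv j g.1 = fun y => (fderiv ℝ g.1 y) (EuclideanSpace.single j 1) := rfl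
    rw [this, fderiv_clm_apply hd3 (differentiableAt_const _)]
    simp
  rw [add_apply, smul_apply,
    smul_apply, h0, h2, smul_zero, add_zero, smul_eq_mul]

theorem T_commute {n : ℕ} (i j : Fin n) : Commute (T i) (T j) := by
  rcases eq_or_ne i j with rfl | hij
  · exact Commute.refl _
  · refine LinearMap.ext fun g => SmoothFun.ext_on fun x hx => ?_
    have hs : IsSymmSndFDerivAt ℝ g.1 x :=
      (g.2.1.contDiffAt ((isOpen_orthant n).mem_nhds hx)).isSymmSndFDerivAt
        (by simp only [minSmoothness_of_isRCLikeNormedField]; exact WithTop.coe_le_coe.2 (le_top : (2 : ℕ∞) ≤ ⊤))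
    rw [Module.End.mul_apply, Module.End.mul_apply, T_apply i _ hx, T_apply j _ hx,
      partialDeriv_T hij g hx, partialDeriv_T hij.symm g hx,
      hs.eq (EuclideanSpace.single i 1) (EuclideanSpace.single j 1)]
    ring

theorem T_mul_list_prod {n : ℕ} (i : Fin n) (k : Fin n → ℕ) (l : List (Fin n)) (hl : l.Nodup)
    (hi : i ∈ l) :
    T i * (l.map fun j => T j ^ k j).reverse.prod
      = (l.map fun j => T j ^ ((k + Pi.single i 1 : Fin n → ℕ) j)).reverse.prod := by
  induction l with
  | nil => simp at hi
  | cons j l ih =>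
    rw [List.nodup_cons] at hl
    simp only [List.map_cons, List.reverse_cons, List.prod_append, List.prod_cons, List.prod_nil,
      mul_one]
    rcases eq_or_ne i j with rfl | hij
    · have h1 : (l.map fun j => T j ^ ((k + Pi.single i 1 : Fin n → ℕ) j)) = l.map fun j => T j ^ k j := by
        refine List.map_congr_left fun a ha => ?_
        have : a ≠ i := fun h => hl.1 (h ▸ ha)
        simp [this]
      have h2 : Commute (T i) (l.map fun j => T j ^ k j).reverse.prod := by
        refine Commute.list_prod_right _ _ fun y hy => ?_
        simp only [List.mem_reverse, List.mem_map] at hy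
        obtain ⟨a, -, rfl⟩ := hy
        exact (T_commute i a).pow_right _
      rw [h1, ← mul_assoc, h2.eq, mul_assoc, ← pow_succ']
      simp
    · have hil : i ∈ l := by simpa [hij] using hi
      rw [← mul_assoc, ih hl.2 hil]
      simp [hij.symm]

theorem T_mul_Tpow {n : ℕ} (i : Fin n) (k : Fin n → ℕ) :
    T i * Tpow k = Tpow (k + Pi.single i 1) :=
  T_mul_list_prod i k _ (List.nodup_finRange n) (List.mem_finRange i)

theorem norm_Tpow_le_gamma {n : ℕ} (μ : Fin n → ℝ) (k : Fin n → ℕ) (φ : H μ)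
    {x : EuclideanSpace ℝ (Fin n)} (hx : x ∈ orthant n) :
    ‖(Tpow k (weightMul μ φ.1)).1 x‖ ≤ gamma μ 0 k φ := by
  have h := le_ciSup (φ.2 0 k) ⟨x, hx⟩
  simp only [weighted, pow_zero, one_mul] at h
  exact h

theorem norm_fderiv_le {n : ℕ} (μ : Fin n → ℝ) (k : Fin n → ℕ) (φ : H μ)
    {x : EuclideanSpace ℝ (Fin n)} (hx : x ∈ orthant n) (hx1 : ‖x‖ ≤ 1) :
    ‖fderiv ℝ (Tpow k (weightMul μ φ.1)).1 x‖
      ≤ ∑ i, gamma μ 0 (k + Pi.single i 1) φ := by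
  have hp : ∀ i, ‖fderiv ℝ (Tpow k (weightMul μ φ.1)).1 x (EuclideanSpace.single i 1)‖
      ≤ gamma μ 0 (k + Pi.single i 1) φ := by
    intro i
    have h1 := norm_Tpow_le_gamma μ (k + Pi.single i 1) φ hx
    rw [← T_mul_Tpow, Module.End.mul_apply, T_apply i _ hx, norm_mul, Complex.norm_real,
      norm_inv, Real.norm_eq_abs, abs_of_pos (hx i)] at h1
    have hxi : x i ≤ 1 := by
      have := PiLp.norm_apply_le x i
      rw [Real.norm_eq_abs, abs_of_pos (hx i)] at this
      exact this.trans hx1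
    refine le_trans ?_ h1
    exact le_mul_of_one_le_left (norm_nonneg _) ((one_le_inv₀ (hx i)).2 hxi)
  refine ContinuousLinearMap.opNorm_le_bound _
    (Finset.sum_nonneg fun i _ => apply_nonneg _ _) fun v => ?_
  have hv : v = ∑ i, v i • EuclideanSpace.single i (1 : ℝ) := by
    ext j
    simp [Pi.single_apply]
  conv_lhs => rw [hv]
  rw [map_sum, Finset.sum_mul]
  refine (norm_sum_le _ _).trans (Finset.sum_le_sum fun i _ => ?_)
  rw [map_smul, norm_smul, mul_comm]
  exact mul_le_mul (hp i) (PiLp.norm_apply_le v i) (norm_nonneg _) (apply_nonneg _ _)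

/-- The limit of `T^k{x^{-μ-1/2} φ(x)}` as `x → 0` within the orthant. -/
def limZero {n : ℕ} (μ : Fin n → ℝ) (k : Fin n → ℕ) (φ : H μ) : ℂ :=
  limUnder (𝓝[orthant n] (0 : EuclideanSpace ℝ (Fin n))) (Tpow k (weightMul μ φ.1)).1

theorem tendsto_limZero {n : ℕ} (μ : Fin n → ℝ) (k : Fin n → ℕ) (φ : H μ) :
    Tendsto (Tpow k (weightMul μ φ.1)).1 (𝓝[orthant n] (0 : EuclideanSpace ℝ (Fin n)))
      (𝓝 (limZero μ k φ)) := by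
  set s : Set (EuclideanSpace ℝ (Fin n)) := orthant n ∩ Metric.ball 0 1 with hs
  have hconv : Convex ℝ s := (convex_orthant n).inter (convex_ball 0 1)
  have hlip : LipschitzOnWith (∑ i, gamma μ 0 (k + Pi.single i 1) φ).toNNReal
      (Tpow k (weightMul μ φ.1)).1 s := by
    refine hconv.lipschitzOnWith_of_nnnorm_fderiv_le
      (fun x hx => SmoothFun.differentiableAt _ hx.1) fun x hx => ?_
    rw [← norm_toNNReal]
    exact Real.toNNReal_le_toNNReal
      (norm_fderiv_le μ k φ hx.1 (mem_ball_zero_iff.1 hx.2).le)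
  have hnh : 𝓝[orthant n] (0 : EuclideanSpace ℝ (Fin n)) = 𝓝[s] 0 := by
    rw [hs, nhdsWithin_inter_of_mem']
    exact mem_nhdsWithin_of_mem_nhds (Metric.ball_mem_nhds 0 one_pos)
  have hc : Cauchy (𝓝[s] (0 : EuclideanSpace ℝ (Fin n))) :=
    cauchy_nhds.mono' (hnh ▸ nhdsWithin_orthant_neBot n) nhdsWithin_le_nhds
  have hc2 : Cauchy (Filter.map (Tpow k (weightMul μ φ.1)).1 (𝓝[s] 0)) :=
    hc.map_of_le hlip.uniformContinuousOn inf_le_right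
  obtain ⟨L, hL⟩ := CompleteSpace.complete hc2
  rw [← hnh] at hL
  exact tendsto_nhds_limUnder ⟨L, hL⟩

/-- The constant `C_μ = ∏ᵢ 2^{μᵢ} Γ(μᵢ + 1)`. -/
def C {n : ℕ} (μ : Fin n → ℝ) : ℝ := ∏ i, (2 : ℝ) ^ μ i * Real.Gamma (μ i + 1)

theorem limZero_add {n : ℕ} (μ : Fin n → ℝ) (k : Fin n → ℕ) (φ ψ : H μ) :
    limZero μ k (φ + ψ) = limZero μ k φ + limZero μ k ψ := by
  refine tendsto_nhds_unique (tendsto_limZero μ k (φ + ψ)) ?_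
  refine ((tendsto_limZero μ k φ).add (tendsto_limZero μ k ψ)).congr fun x => ?_
  simp

theorem limZero_smul {n : ℕ} (μ : Fin n → ℝ) (k : Fin n → ℕ) (c : ℂ) (φ : H μ) :
    limZero μ k (c • φ) = c * limZero μ k φ := by
  refine tendsto_nhds_unique (tendsto_limZero μ k (c • φ)) ?_
  refine ((tendsto_limZero μ k φ).const_mul c).congr fun x => ?_
  simp

theorem norm_limZero_le {n : ℕ} (μ : Fin n → ℝ) (k : Fin n → ℕ) (φ : H μ) :
    ‖limZero μ k φ‖ ≤ gamma μ 0 k φ :=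
  le_of_tendsto (tendsto_limZero μ k φ).norm
    (by filter_upwards [self_mem_nhdsWithin] with x hx using norm_Tpow_le_gamma μ k φ hx)

/-- The linear functional `φ ↦ C_μ lim_{x → 0, xᵢ > 0} T^k{x^{-μ-1/2} φ(x)}` on `H_μ`. -/
def TdeltaLin {n : ℕ} (μ : Fin n → ℝ) (k : Fin n → ℕ) : H μ →ₗ[ℂ] ℂ where
  toFun φ := (C μ : ℂ) * limZero μ k φ
  map_add' φ ψ := by rw [limZero_add, mul_add]
  map_smul' c φ := by
    rw [limZero_smul, RingHom.id_apply, smul_eq_mul]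
    ring

/-- The functional `T^k δ_μ ∈ H'_μ`,
`(T^k δ_μ, φ) = C_μ lim_{x → 0, xᵢ > 0} T^k{x^{-μ-1/2} φ(x)}`. -/
def Tdelta {n : ℕ} (μ : Fin n → ℝ) (k : Fin n → ℕ) : Dual μ where
  toLinearMap := TdeltaLin μ k
  cont := by
    refine WithSeminorms.continuous_normedSpace_rng ℂ (withSeminorms_H μ) (TdeltaLin μ k)
      ⟨{(0, k)}, ‖(C μ : ℂ)‖₊, fun φ => ?_⟩
    have h : ‖TdeltaLin μ k φ‖ ≤ ‖(C μ : ℂ)‖ * gamma μ 0 k φ := by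
      change ‖(C μ : ℂ) * limZero μ k φ‖ ≤ _
      rw [norm_mul]
      exact mul_le_mul_of_nonneg_left (norm_limZero_le μ k φ) (norm_nonneg _)
    simpa [gammaFamily, NNReal.smul_def] using h

/-- The finite set of multi-indices `k ∈ ℕ₀ⁿ` with `|k| = k₁ + ⋯ + kₙ ≤ N`. -/
def multiIndices (n N : ℕ) : Finset (Fin n → ℕ) :=
  (Fintype.piFinset fun _ => Finset.range (N + 1)).filter fun k => ∑ i, k i ≤ N

theorem mem_multiIndices {n N : ℕ} {k : Fin n → ℕ} : k ∈ multiIndices n N ↔ ∑ i, k i ≤ N := by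
  simp only [multiIndices, Finset.mem_filter, Fintype.mem_piFinset, Finset.mem_range,
    and_iff_right_iff_imp]
  intro h i
  have := Finset.single_le_sum (f := k) (fun _ _ => Nat.zero_le _) (Finset.mem_univ i)
  omega

end Zemanian

end

noncomputable section

namespace Zemanian

/-! Continuity bounds `f` by finitely many seminorms; let `N` dominate their orders. It is enough
that `f φ = 0` whenever the limits of `T^k{x^{-μ-1/2} φ}` at the origin vanish for `|k| ≤ N`: then
`f` vanishes on the common kernel of finitely many functionals, and linear algebra makes it a
combination of them (`exists_eq_sum_of_forall_eq_zero`).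

For such a `φ`, localize with a cutoff `χ_r(x) = profile(‖x‖²/r)`. The difference `φ - χ_r φ` is
supported away from `0`, so `f φ = f (χ_r φ)` for every `r > 0`. Two scalings meet. Along a ray,
`d/dt g(tx) = t ∑ xᵢ² (Tᵢ g)(tx)`, so each vanishing order gains a factor `‖x‖²` and `T^b{x^{-μ-1/2}
φ} = O(‖x‖^{2(N+1-|b|)})` (`norm_Tpow_le_of_limZero_eq_zero`). Since `Tᵢ` acts on functions of
`‖x‖²` as twice the derivative, `T^a χ_r = O(r^{-|a|})`. By the Leibniz rule the seminorms of `χ_r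
φ` are `O(r^{N+1-|k|}) = O(r)` (`exists_gamma_cutoff_mul_le`), and `r → 0` gives `f φ = 0`
(`exists_order`). -/

/-! ### Commutation and induction over multi-indices -/

theorem commute_T_Tpow {n : ℕ} (i : Fin n) (k : Fin n → ℕ) : Commute (T i) (Tpow k) := by
  refine Commute.list_prod_right _ _ fun y hy => ?_
  simp only [List.mem_reverse, List.mem_map] at hy
  obtain ⟨a, -, rfl⟩ := hy
  exact (T_commute i a).pow_right _

theorem T_Tpow_apply {n : ℕ} (i : Fin n) (k : Fin n → ℕ) (g : SmoothFun n) :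
    T i (Tpow k g) = Tpow (k + Pi.single i 1) g := by
  rw [← T_mul_Tpow, Module.End.mul_apply]

theorem Tpow_T_apply {n : ℕ} (i : Fin n) (k : Fin n → ℕ) (g : SmoothFun n) :
    Tpow k (T i g) = Tpow (k + Pi.single i 1) g := by
  rw [← T_mul_Tpow, (commute_T_Tpow i k).eq, Module.End.mul_apply]

theorem Tpow_zero {n : ℕ} : Tpow (0 : Fin n → ℕ) = 1 := by
  simp [Tpow]

theorem sum_add_single {n : ℕ} (k : Fin n → ℕ) (i : Fin n) :
    ∑ j, (k + Pi.single i 1 : Fin n → ℕ) j = ∑ j, k j + 1 := by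
  simp [Finset.sum_add_distrib]

/-- Induction on multi-indices by raising one entry at a time. -/
theorem multiIndex_induction {n : ℕ} {P : (Fin n → ℕ) → Prop} (zero : P 0)
    (add_single : ∀ k i, P k → P (k + Pi.single i 1)) (k : Fin n → ℕ) : P k := by
  induction hs : ∑ i, k i generalizing k with
  | zero =>
    have : k = 0 := by
      funext i
      exact (Finset.sum_eq_zero_iff.1 hs) i (Finset.mem_univ i)
    exact this ▸ zero
  | succ s ih =>
    obtain ⟨i, -, hi⟩ := Finset.exists_ne_zero_of_sum_ne_zero (by omega : ∑ i, k i ≠ 0)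
    -- The subtraction is truncated; it is exact here because `k i ≠ 0`.
    have hk : k = (k - Pi.single i 1) + Pi.single i 1 := by
      funext j
      rcases eq_or_ne j i with rfl | hj
      · simp; omega
      · simp [hj]
    have h2 := sum_add_single (k - Pi.single i 1) i
    rw [← hk] at h2
    rw [hk]
    exact add_single _ _ (ih _ (by omega))

/-! ### Products -/

/-- The pointwise product of two smooth functions on the orthant. -/
def SmoothFun.mul {n : ℕ} (u v : SmoothFun n) : SmoothFun n :=
  ⟨fun x => u.1 x * v.1 x, u.2.1.mul v.2.1, fun x hx => by simp [u.2.2 x hx]⟩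

theorem T_mul {n : ℕ} (i : Fin n) (u v : SmoothFun n) :
    T i (SmoothFun.mul u v) = SmoothFun.mul (T i u) v + SmoothFun.mul u (T i v) := by
  refine SmoothFun.ext_on fun x hx => ?_
  have h : fderiv ℝ (SmoothFun.mul u v).1 x = u.1 x • fderiv ℝ v.1 x + v.1 x • fderiv ℝ u.1 x :=
    fderiv_fun_mul (SmoothFun.differentiableAt u hx) (SmoothFun.differentiableAt v hx)
  change _ = (T i u).1 x * v.1 x + u.1 x * (T i v).1 x
  rw [T_apply i _ hx, T_apply i _ hx, T_apply i _ hx, partialDeriv, h]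
  simp only [partialDeriv, add_apply, smul_apply, smul_eq_mul]
  ring

/-- A bound for all products `T^a u · T^b v` with `a + b = k` yields one for `T^k (u v)`. -/
theorem norm_Tpow_mul_le {n : ℕ} (u v : SmoothFun n) (x : EuclideanSpace ℝ (Fin n)) {B : ℝ}
    (k : Fin n → ℕ)
    (hB : ∀ a b, a + b = k → ‖(Tpow a u).1 x‖ * ‖(Tpow b v).1 x‖ ≤ B) :
    ‖(Tpow k (SmoothFun.mul u v)).1 x‖ ≤ 2 ^ (∑ i, k i) * B := by
  induction k using multiIndex_induction generalizing u v B with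
  | zero => simpa [Tpow_zero, SmoothFun.mul] using hB 0 0 (add_zero 0)
  | add_single k i ih =>
    -- Peeling off the innermost `Tᵢ` splits the product into two terms with the same bound `B`;
    -- this doubling is the source of `2 ^ |k|`, and no binomial coefficients are needed.
    have h1 := ih (T i u) v fun a b hab => by
      rw [Tpow_T_apply]
      exact hB _ _ (by rw [← hab]; abel)
    have h2 := ih u (T i v) fun a b hab => by
      rw [Tpow_T_apply]
      exact hB _ _ (by rw [← hab]; abel)
    rw [← Tpow_T_apply, T_mul, map_add, sum_add_single, pow_succ]
    refine (norm_add_le _ _).trans ?_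
    linarith

/-- A multiplier passes through the weight, so the Leibniz rule applies with `x^{-μ-1/2} φ` as one
factor. -/
theorem weightMul_mul {n : ℕ} (μ : Fin n → ℝ) (u φ : SmoothFun n) :
    weightMul μ (SmoothFun.mul u φ) = SmoothFun.mul u (weightMul μ φ) :=
  Subtype.ext (funext fun x => mul_left_comm _ (u.1 x) (φ.1 x))

theorem weighted_le_gamma {n : ℕ} (μ : Fin n → ℝ) (m : ℕ) (k : Fin n → ℕ) (φ : H μ)
    (x : orthant n) : weighted μ m k φ.1 x ≤ gamma μ m k φ :=
  le_ciSup (φ.2 m k) x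

theorem gamma_le {n : ℕ} {μ : Fin n → ℝ} {m : ℕ} {k : Fin n → ℕ} {φ : H μ} {A : ℝ}
    (h : ∀ x, weighted μ m k φ.1 x ≤ A) : gamma μ m k φ ≤ A :=
  ciSup_le h

/-- Functions with bounded `T`-derivatives are multipliers of `H_μ`. -/
theorem mul_mem_H {n : ℕ} {μ : Fin n → ℝ} {u : SmoothFun n}
    (hu : ∀ N : ℕ, ∃ D, ∀ a : Fin n → ℕ, ∑ i, a i ≤ N → ∀ x ∈ orthant n, ‖(Tpow a u).1 x‖ ≤ D)
    (φ : H μ) : SmoothFun.mul u φ.1 ∈ H μ := by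
  intro m k
  obtain ⟨D, hD⟩ := hu (∑ i, k i)
  set E := ∑ b ∈ multiIndices n (∑ i, k i), gamma μ m b φ
  have hE : 0 ≤ E := Finset.sum_nonneg fun b _ => apply_nonneg _ _
  refine ⟨2 ^ (∑ i, k i) * (D * E), ?_⟩
  rintro _ ⟨x, rfl⟩
  have hw : 0 < (1 + ‖x.1‖ ^ 2) ^ m := by positivity
  -- The bound `B` is chosen for this `x`: it carries the inverse weight, which cancels at the end.
  have key := norm_Tpow_mul_le u (weightMul μ φ.1) x.1 (B := D * (E / (1 + ‖x.1‖ ^ 2) ^ m)) k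
    fun a b hab => by
      have hs : ∑ i, a i + ∑ i, b i = ∑ i, k i := by
        rw [← hab]; simp [Finset.sum_add_distrib]
      have ha := hD a (by omega) x.1 x.2
      refine mul_le_mul ha ?_ (norm_nonneg _) ((norm_nonneg _).trans ha)
      rw [le_div_iff₀' hw]
      exact (weighted_le_gamma μ m b φ x).trans
        (Finset.single_le_sum (f := fun b => gamma μ m b φ) (fun b _ => apply_nonneg _ _)
          (mem_multiIndices.2 (by omega)))
  unfold weighted
  rw [weightMul_mul]
  refine (mul_le_mul_of_nonneg_left key hw.le).trans_eq ?_
  field_simp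

/-! ### Radial functions and cutoffs -/

/-- The function `x ↦ F(‖x‖²)` on the orthant. -/
def radial (n : ℕ) (F : ℝ → ℂ) (hF : ContDiff ℝ ∞ F) : SmoothFun n :=
  ⟨(orthant n).indicator fun x => F (‖x‖ ^ 2),
    (hF.comp (contDiff_norm_sq ℝ)).contDiffOn.congr fun _ hx => Set.indicator_of_mem hx _,
    fun _ hx => Set.indicator_of_notMem hx _⟩

theorem radial_apply {n : ℕ} {F : ℝ → ℂ} (hF : ContDiff ℝ ∞ F) {x : EuclideanSpace ℝ (Fin n)}
    (hx : x ∈ orthant n) : (radial n F hF).1 x = F (‖x‖ ^ 2) :=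
  Set.indicator_of_mem hx fun x => F (‖x‖ ^ 2)

/-- The factor `xᵢ⁻¹` cancels the `xᵢ` in `∂ᵢ‖x‖² = 2xᵢ`: the result is radial again, nonsingular
and independent of `i`. -/
theorem T_radial_apply {n : ℕ} {F : ℝ → ℂ} (hF : ContDiff ℝ ∞ F) (i : Fin n)
    {x : EuclideanSpace ℝ (Fin n)} (hx : x ∈ orthant n) :
    (T i (radial n F hF)).1 x = 2 * deriv F (‖x‖ ^ 2) := by
  have he : (radial n F hF).1 =ᶠ[𝓝 x] fun y => F (‖y‖ ^ 2) :=
    Filter.eventually_of_mem ((isOpen_orthant n).mem_nhds hx) fun y hy => radial_apply hF hy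
  have h1 := (hasFDerivAt_id (𝕜 := ℝ) x).norm_sq
  have h2 : HasDerivAt F (deriv F (‖x‖ ^ 2)) (‖x‖ ^ 2) :=
    (hF.differentiable (by simp)).differentiableAt.hasDerivAt
  have h3 := h2.hasFDerivAt.comp x h1
  rw [T_apply i _ hx, partialDeriv, he.fderiv_eq]
  have h4 : fderiv ℝ (fun y : EuclideanSpace ℝ (Fin n) => F (‖y‖ ^ 2)) x = _ := h3.fderiv
  rw [h4]
  have hxi : ((x i : ℝ) : ℂ) ≠ 0 := by exact_mod_cast (hx i).ne'
  simp [EuclideanSpace.inner_single_right]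
  field_simp

theorem Tpow_radial_apply {n : ℕ} {F : ℝ → ℂ} (hF : ContDiff ℝ ∞ F) (k : Fin n → ℕ)
    {x : EuclideanSpace ℝ (Fin n)} (hx : x ∈ orthant n) :
    (Tpow k (radial n F hF)).1 x = 2 ^ (∑ i, k i) * iteratedDeriv (∑ i, k i) F (‖x‖ ^ 2) := by
  induction k using multiIndex_induction generalizing F with
  | zero => simp [Tpow_zero, radial_apply hF hx]
  | add_single k i ih =>
    have hF' : ContDiff ℝ ∞ (deriv F) := ContDiff.deriv' hF
    have hT : T i (radial n F hF) = (2 : ℂ) • radial n (deriv F) hF' := by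
      refine SmoothFun.ext_on fun y hy => ?_
      rw [T_radial_apply hF i hy]
      change _ = 2 * (radial n (deriv F) hF').1 y
      rw [radial_apply hF' hy]
    rw [← Tpow_T_apply, hT, map_smul, sum_add_single, iteratedDeriv_succ']
    change 2 * (Tpow k (radial n (deriv F) hF')).1 x = _
    rw [ih hF']
    ring

/-- A smooth function on the line that is `1` on `[-1/2, 1/2]` and vanishes outside `[-1, 1]`. -/
def profile (t : ℝ) : ℂ :=
  (((⟨1 / 2, 1, by norm_num, by norm_num⟩ : ContDiffBump (0 : ℝ)) t : ℝ) : ℂ)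

theorem contDiff_profile : ContDiff ℝ ∞ profile :=
  Complex.ofRealCLM.contDiff.comp (ContDiffBump.contDiff _)

theorem profile_eq_one {t : ℝ} (ht : |t| ≤ 1 / 2) : profile t = 1 := by
  unfold profile
  rw [ContDiffBump.one_of_mem_closedBall]
  · simp
  · simpa [Metric.mem_closedBall, Real.dist_eq] using ht

theorem tsupport_profile_subset : tsupport profile ⊆ Metric.closedBall 0 1 := by
  refine closure_minimal (fun t ht => ?_) Metric.isClosed_closedBall
  by_contra h
  refine ht ?_
  unfold profile
  rw [ContDiffBump.zero_of_le_dist]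
  · simp
  · exact (not_le.1 h).le

theorem tsupport_iteratedDeriv_profile_subset (q : ℕ) :
    tsupport (iteratedDeriv q profile) ⊆ Metric.closedBall 0 1 := by
  induction q with
  | zero => simpa using tsupport_profile_subset
  | succ q ih =>
    rw [iteratedDeriv_succ]
    exact tsupport_deriv_subset.trans ih

theorem iteratedDeriv_profile_eq_zero (q : ℕ) {t : ℝ} (ht : 1 < t) :
    iteratedDeriv q profile t = 0 := by
  refine image_eq_zero_of_notMem_tsupport fun h => ?_
  have := tsupport_iteratedDeriv_profile_subset q h
  rw [mem_closedBall_zero_iff, Real.norm_eq_abs, abs_of_pos (by linarith)] at this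
  linarith

theorem exists_bound_iteratedDeriv_profile (N : ℕ) :
    ∃ M, 0 ≤ M ∧ ∀ q ≤ N, ∀ t, ‖iteratedDeriv q profile t‖ ≤ M := by
  have h : ∀ q, ∃ M, ∀ t, ‖iteratedDeriv q profile t‖ ≤ M := fun q =>
    (HasCompactSupport.of_support_subset_isCompact (isCompact_closedBall (0 : ℝ) 1)
      ((subset_tsupport _).trans
        (tsupport_iteratedDeriv_profile_subset q))).exists_bound_of_continuous
      (contDiff_profile.continuous_iteratedDeriv q (by exact_mod_cast le_top))
  choose M hM using h
  have h0 : ∀ q, 0 ≤ M q := fun q => (norm_nonneg _).trans (hM q 0)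
  refine ⟨∑ q ∈ Finset.range (N + 1), M q, Finset.sum_nonneg fun q _ => h0 q, fun q hq t => ?_⟩
  exact (hM q t).trans (Finset.single_le_sum (f := M) (fun q _ => h0 q)
    (Finset.mem_range.2 (by omega)))

theorem contDiff_profile_scale (c : ℝ) : ContDiff ℝ ∞ fun t => profile (c * t) :=
  contDiff_profile.comp (contDiff_const.mul contDiff_id)

/-- The radial cutoff `x ↦ profile (c ‖x‖²)`. -/
def cutoff (n : ℕ) (c : ℝ) : SmoothFun n :=
  radial n (fun t => profile (c * t)) (contDiff_profile_scale c)

/-- With `c = r⁻¹`, each `Tᵢ` costs one factor `r⁻¹`, to be paid for by the bound `‖x‖² ≤ r` on the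
support. -/
theorem norm_Tpow_cutoff {n : ℕ} {c : ℝ} (hc : 0 ≤ c) (k : Fin n → ℕ)
    {x : EuclideanSpace ℝ (Fin n)} (hx : x ∈ orthant n) :
    ‖(Tpow k (cutoff n c)).1 x‖
      = (2 * c) ^ (∑ i, k i) * ‖iteratedDeriv (∑ i, k i) profile (c * ‖x‖ ^ 2)‖ := by
  rw [cutoff, Tpow_radial_apply _ k hx,
    iteratedDeriv_comp_const_smul (contDiff_profile.of_le (by exact_mod_cast le_top))]
  simp only [norm_mul, norm_smul, norm_pow, Real.norm_eq_abs, abs_of_nonneg hc, mul_pow]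
  simp [mul_assoc]

theorem cutoff_mul_mem_H {n : ℕ} {μ : Fin n → ℝ} {c : ℝ} (hc : 0 ≤ c) (φ : H μ) :
    SmoothFun.mul (cutoff n c) φ.1 ∈ H μ := by
  refine mul_mem_H (fun N => ?_) φ
  obtain ⟨M, hM0, hM⟩ := exists_bound_iteratedDeriv_profile N
  refine ⟨(1 + 2 * c) ^ N * M, fun a ha x hx => ?_⟩
  rw [norm_Tpow_cutoff hc a hx]
  refine mul_le_mul ?_ (hM _ ha _) (norm_nonneg _) (by positivity)
  -- Replacing `2c` by `1 + 2c ≥ 1` allows the exponent to be raised to `N` even for small `c`.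
  exact (pow_le_pow_left₀ (by positivity) (by linarith) _).trans
    (pow_le_pow_right₀ (by linarith) ha)

/-! ### Functions whose low-order `T`-derivatives vanish at the origin -/

/-- If `Tᵢ g = O(‖x‖^{2p})` for every `i` and `g` tends to `0` at the origin, then
`g = O(‖x‖^{2(p+1)})`. -/
theorem norm_le_of_norm_T_le {n : ℕ} {g : SmoothFun n} {A : ℝ} {p : ℕ}
    (h0 : Tendsto g.1 (𝓝[orthant n] 0) (𝓝 0))
    (hT : ∀ i, ∀ x ∈ orthant n, ‖(T i g).1 x‖ ≤ A * (‖x‖ ^ 2) ^ p) (hA : 0 ≤ A)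
    {x : EuclideanSpace ℝ (Fin n)} (hx : x ∈ orthant n) :
    ‖g.1 x‖ ≤ A * (‖x‖ ^ 2) ^ (p + 1) := by
  have hmem : ∀ t : ℝ, 0 < t → t • x ∈ orthant n := fun t ht i => by
    simpa using mul_pos ht (hx i)
  -- The interval omits `0`, since the origin lies outside the orthant; the value there enters only
  -- as a limit.
  have hderiv : ∀ t ∈ Set.Ioc (0 : ℝ) 1, HasDerivWithinAt (fun t : ℝ => g.1 (t • x))
      (fderiv ℝ g.1 (t • x) x) (Set.Ioc 0 1) t := by
    intro t ht
    have h1 : HasDerivAt (fun t : ℝ => t • x) x t := by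
      simpa using (hasDerivAt_id t).smul_const x
    exact ((SmoothFun.differentiableAt g (hmem t ht.1)).hasFDerivAt.comp_hasDerivAt t
      h1).hasDerivWithinAt
  have hbound : ∀ t ∈ Set.Ioc (0 : ℝ) 1,
      ‖fderiv ℝ g.1 (t • x) x‖ ≤ A * (‖x‖ ^ 2) ^ (p + 1) := by
    intro t ht
    have hv : x = ∑ i, x i • EuclideanSpace.single i (1 : ℝ) := by
      ext j
      simp [Pi.single_apply]
    have hsum : fderiv ℝ g.1 (t • x) x
        = ∑ i, x i • fderiv ℝ g.1 (t • x) (EuclideanSpace.single i 1) := by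
      conv_lhs => rw [show fderiv ℝ g.1 (t • x) x = fderiv ℝ g.1 (t • x)
        (∑ i, x i • EuclideanSpace.single i (1 : ℝ)) from congrArg _ hv]
      simp only [map_sum, map_smul]
    -- Here `∂ᵢg(tx) = t xᵢ (Tᵢ g)(tx)`, so the extra `xᵢ` gives `xᵢ²`, and summation over `i`
    -- yields the gain `‖x‖²`.
    have hi : ∀ i, ‖x i • fderiv ℝ g.1 (t • x) (EuclideanSpace.single i 1)‖
        ≤ x i ^ 2 * (A * (‖x‖ ^ 2) ^ p) := by
      intro i
      have h1 := hT i _ (hmem t ht.1)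
      have hti : 0 < t * x i := mul_pos ht.1 (hx i)
      rw [T_apply i _ (hmem t ht.1), partialDeriv, norm_mul, Complex.norm_real, norm_inv,
        Real.norm_eq_abs, PiLp.smul_apply, smul_eq_mul, abs_of_pos hti,
        inv_mul_le_iff₀ hti] at h1
      have h2 : ‖t • x‖ ≤ ‖x‖ := by
        rw [norm_smul, Real.norm_eq_abs, abs_of_pos ht.1]
        exact mul_le_of_le_one_left (norm_nonneg _) ht.2
      rw [norm_smul, Real.norm_eq_abs, abs_of_pos (hx i), pow_two, mul_assoc]
      refine mul_le_mul_of_nonneg_left (h1.trans ?_) (hx i).le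
      refine mul_le_mul (mul_le_of_le_one_left (hx i).le ht.2) ?_ (by positivity) (hx i).le
      gcongr
    rw [hsum]
    refine (norm_sum_le _ _).trans ((Finset.sum_le_sum fun i _ => hi i).trans_eq ?_)
    rw [← Finset.sum_mul, ← EuclideanSpace.real_norm_sq_eq]
    ring
  have hmvt : ∀ s ∈ Set.Ioc (0 : ℝ) 1,
      ‖g.1 x - g.1 (s • x)‖ ≤ A * (‖x‖ ^ 2) ^ (p + 1) := by
    intro s hs
    have := (convex_Ioc (0 : ℝ) 1).norm_image_sub_le_of_norm_hasDerivWithin_le hderiv hbound hs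
      (Set.right_mem_Ioc.2 one_pos)
    rw [one_smul] at this
    refine this.trans (mul_le_of_le_one_right (by positivity) ?_)
    rw [Real.norm_eq_abs, abs_of_nonneg (by linarith [hs.2])]
    linarith [hs.1]
  have hlim : Tendsto (fun s : ℝ => s • x) (𝓝[>] 0) (𝓝[orthant n] 0) := by
    refine tendsto_nhdsWithin_iff.2 ⟨?_, ?_⟩
    · have : Continuous fun s : ℝ => s • x := by fun_prop
      have h2 := this.tendsto 0
      rw [zero_smul] at h2
      exact h2.mono_left nhdsWithin_le_nhds
    · filter_upwards [self_mem_nhdsWithin] with s hs using hmem s hs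
  have hlim2 := ((h0.comp hlim).const_sub (g.1 x)).norm
  rw [sub_zero] at hlim2
  refine le_of_tendsto hlim2 ?_
  filter_upwards [Ioc_mem_nhdsGT (one_pos : (0 : ℝ) < 1)] with s hs using hmvt s hs

/-- If the limits of `T^k{x^{-μ-1/2} φ(x)}` at the origin vanish for `|k| ≤ N`, then these
derivatives are `O(‖x‖^{2(N+1-|k|)})`. -/
theorem norm_Tpow_le_of_limZero_eq_zero {n N : ℕ} {μ : Fin n → ℝ} {φ : H μ}
    (h0 : ∀ k : Fin n → ℕ, ∑ i, k i ≤ N → limZero μ k φ = 0) (p : ℕ) (k : Fin n → ℕ)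
    (hk : ∑ i, k i + p = N + 1) {x : EuclideanSpace ℝ (Fin n)} (hx : x ∈ orthant n) :
    ‖(Tpow k (weightMul μ φ.1)).1 x‖
      ≤ (∑ l ∈ multiIndices n (N + 1), gamma μ 0 l φ) * (‖x‖ ^ 2) ^ p := by
  -- The start `p = 0` is `|k| = N + 1`, where only boundedness is known; each step lowers `|k|` by
  -- one and gains `‖x‖²`.
  induction p generalizing k x with
  | zero =>
    rw [pow_zero, mul_one]
    exact (norm_Tpow_le_gamma μ k φ hx).trans
      (Finset.single_le_sum (f := fun l => gamma μ 0 l φ) (fun l _ => apply_nonneg _ _)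
        (mem_multiIndices.2 (by omega)))
  | succ p ih =>
    refine norm_le_of_norm_T_le (h0 k (by omega) ▸ tendsto_limZero μ k φ) (fun i y hy => ?_)
      (Finset.sum_nonneg fun l _ => apply_nonneg _ _) hx
    rw [T_Tpow_apply]
    exact ih _ (by rw [sum_add_single]; omega) hy

/-- Under the same hypothesis, the seminorms of order at most `N` of the localizations of `φ` to
shrinking balls tend to `0`. -/
theorem exists_gamma_cutoff_mul_le {n N : ℕ} {μ : Fin n → ℝ} {φ : H μ}
    (h0 : ∀ k : Fin n → ℕ, ∑ i, k i ≤ N → limZero μ k φ = 0) :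
    ∃ K, ∀ (r : ℝ) (hr : 0 < r), r ≤ 1 → ∀ m ≤ N, ∀ k : Fin n → ℕ, ∑ i, k i ≤ N →
      gamma μ m k ⟨SmoothFun.mul (cutoff n r⁻¹) φ.1, cutoff_mul_mem_H (inv_nonneg.2 hr.le) φ⟩
        ≤ K * r := by
  obtain ⟨M, hM0, hM⟩ := exists_bound_iteratedDeriv_profile N
  set A := ∑ l ∈ multiIndices n (N + 1), gamma μ 0 l φ
  have hA0 : 0 ≤ A := Finset.sum_nonneg fun l _ => apply_nonneg _ _
  -- The three powers of `2` come, in order, from the weight on `‖x‖² ≤ r ≤ 1`, the Leibniz rule and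
  -- the derivatives of the cutoff.
  refine ⟨2 ^ N * (2 ^ N * (2 ^ N * M * A)), fun r hr hr1 m hm k hk => gamma_le fun x => ?_⟩
  have hprod : ∀ a b, a + b = k → ‖(Tpow a (cutoff n r⁻¹)).1 x‖
      * ‖(Tpow b (weightMul μ φ.1)).1 x‖ ≤ if ‖x.1‖ ^ 2 ≤ r then 2 ^ N * M * A * r else 0 := by
    intro a b hab
    have hs : ∑ i, a i + ∑ i, b i = ∑ i, k i := by
      rw [← hab]; simp [Finset.sum_add_distrib]
    rw [norm_Tpow_cutoff (inv_nonneg.2 hr.le) a x.2]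
    split_ifs with hxr
    -- Of the available powers of `‖x‖² ≤ r`, `|a|` cancel `r^{-|a|}`, one gives the decay, and the
    -- remaining `p = N - |k|` are dropped as `r ≤ 1`.
    · obtain ⟨p, hp⟩ : ∃ p, ∑ i, b i + (∑ i, a i + p + 1) = N + 1 :=
        ⟨N - ∑ i, k i, by omega⟩
      have h1 := norm_Tpow_le_of_limZero_eq_zero h0 _ b hp x.2
      have h2 : (‖x.1‖ ^ 2) ^ (∑ i, a i + p + 1) ≤ r ^ (∑ i, a i) * r := by
        refine (pow_le_pow_left₀ (by positivity) hxr _).trans ?_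
        rw [← pow_succ]
        exact pow_le_pow_of_le_one hr.le hr1 (by omega)
      have h3 : (2 : ℝ) ^ (∑ i, a i) ≤ 2 ^ N := pow_le_pow_right₀ one_le_two (by omega)
      calc _ ≤ (2 * r⁻¹) ^ (∑ i, a i) * M * (A * (r ^ (∑ i, a i) * r)) := by
            refine mul_le_mul ?_ (h1.trans (mul_le_mul_of_nonneg_left h2 hA0)) (norm_nonneg _)
              (by positivity)
            exact mul_le_mul_of_nonneg_left (hM _ (by omega) _) (by positivity)
        _ = 2 ^ (∑ i, a i) * M * A * r := by
            rw [mul_pow, inv_pow]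
            field_simp
        _ ≤ _ := by gcongr
    · rw [iteratedDeriv_profile_eq_zero]
      · simp
      · rw [not_le] at hxr
        rwa [inv_mul_eq_div, one_lt_div hr]
  have key := norm_Tpow_mul_le _ _ x.1 k hprod
  unfold weighted
  rw [weightMul_mul]
  split_ifs at key with hxr
  · have hw : (1 + ‖x.1‖ ^ 2) ^ m ≤ 2 ^ N :=
      (pow_le_pow_left₀ (by positivity) (by linarith) m).trans (pow_le_pow_right₀ one_le_two hm)
    have h3 : (2 : ℝ) ^ (∑ i, k i) ≤ 2 ^ N := pow_le_pow_right₀ one_le_two hk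
    calc _ ≤ (2 : ℝ) ^ N * (2 ^ N * (2 ^ N * M * A * r)) := by
          refine mul_le_mul hw (key.trans ?_) (norm_nonneg _) (by positivity)
          gcongr
      _ = _ := by ring
  · rw [mul_zero] at key
    rw [le_antisymm key (norm_nonneg _), mul_zero]
    positivity

/-! ### Functionals supported at the origin -/

/-- The cutoff is `1` where `‖x‖² ≤ r/2`, whence the radius `√(r/2)`. This makes the hypothesis on
`f` applicable to the difference. -/
theorem supp_sub_cutoff_mul_subset {n : ℕ} {μ : Fin n → ℝ} (φ : H μ) {r : ℝ} (hr : 0 < r) :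
    ∃ a : ℝ, 0 < a ∧
      supp (φ - ⟨SmoothFun.mul (cutoff n r⁻¹) φ.1, cutoff_mul_mem_H (inv_nonneg.2 hr.le) φ⟩)
        ⊆ {x | x ∈ orthant n ∧ a ≤ ‖x‖} := by
  refine ⟨√(r / 2), Real.sqrt_pos.2 (by positivity), fun x hx => ⟨hx.2, ?_⟩⟩
  have hcl : IsClosed {x : EuclideanSpace ℝ (Fin n) | √(r / 2) ≤ ‖x‖} :=
    isClosed_le continuous_const continuous_norm
  refine closure_minimal (fun y hy => ?_) hcl hx.1
  by_contra hlt
  refine hy ?_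
  change φ.1.1 y - (cutoff n r⁻¹).1 y * φ.1.1 y = 0
  by_cases hyo : y ∈ orthant n
  · have hsq : ‖y‖ ^ 2 ≤ r / 2 :=
      ((Real.lt_sqrt (norm_nonneg _)).1 (not_le.1 hlt)).le
    have h1 : (cutoff n r⁻¹).1 y = 1 := by
      rw [cutoff, radial_apply _ hyo]
      refine profile_eq_one ?_
      rw [abs_of_nonneg (by positivity), inv_mul_le_iff₀ hr]
      linarith
    rw [h1, one_mul, sub_self]
  · rw [φ.1.2.2 y hyo]
    simp

/-- A functional that vanishes away from the origin depends only on finitely many of the limits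
of `T^k{x^{-μ-1/2} φ(x)}` at the origin. -/
theorem exists_order {n : ℕ} {μ : Fin n → ℝ} (f : Dual μ)
    (hf : ∀ φ : H μ, (∃ a : ℝ, 0 < a ∧ supp φ ⊆ {x | x ∈ orthant n ∧ a ≤ ‖x‖}) → f φ = 0) :
    ∃ N : ℕ, ∀ φ : H μ, (∀ k : Fin n → ℕ, ∑ i, k i ≤ N → limZero μ k φ = 0) → f φ = 0 := by
  obtain ⟨s, C₀, -, hC₀⟩ := Seminorm.bound_of_continuous (withSeminorms_H μ)
    ((normSeminorm ℂ ℂ).comp f.toLinearMap) (continuous_norm.comp f.continuous)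
  -- The sum `m + |k|` dominates both `m` and `|k|`, as the cutoff estimate requires.
  refine ⟨s.sup fun q => q.1 + ∑ i, q.2 i, fun φ h0 => ?_⟩
  obtain ⟨K, hK⟩ := exists_gamma_cutoff_mul_le h0
  have hbound : ∀ r ∈ Set.Ioc (0 : ℝ) 1, ‖f φ‖ ≤ C₀ * (|K| * r) := by
    intro r hr
    set ψ : H μ :=
      ⟨SmoothFun.mul (cutoff n r⁻¹) φ.1, cutoff_mul_mem_H (inv_nonneg.2 hr.1.le) φ⟩
    have h1 : f φ = f ψ := by
      have := hf (φ - ψ) (supp_sub_cutoff_mul_subset φ hr.1)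
      exact sub_eq_zero.1 ((f.toLinearMap.map_sub φ ψ).symm.trans this)
    have h2 : ‖f ψ‖ ≤ C₀ * (s.sup (gammaFamily μ)) ψ := hC₀ ψ
    rw [h1]
    refine h2.trans (mul_le_mul_of_nonneg_left ?_ C₀.2)
    refine Seminorm.finset_sup_apply_le (mul_nonneg (abs_nonneg _) hr.1.le) fun q hq => ?_
    have hle := Finset.le_sup (f := fun q : ℕ × (Fin n → ℕ) => q.1 + ∑ i, q.2 i) hq
    exact (hK r hr.1 hr.2 q.1 (le_trans (by simp) hle) q.2 (le_trans (by simp) hle)).trans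
      (mul_le_mul_of_nonneg_right (le_abs_self K) hr.1.le)
  have hlim : Tendsto (fun r : ℝ => (C₀ : ℝ) * (|K| * r)) (𝓝[>] 0) (𝓝 0) := by
    have : Continuous fun r : ℝ => (C₀ : ℝ) * (|K| * r) := by fun_prop
    have h2 := this.tendsto 0
    simp only [mul_zero] at h2
    exact h2.mono_left nhdsWithin_le_nhds
  refine norm_le_zero_iff.1 (ge_of_tendsto hlim ?_)
  filter_upwards [Ioc_mem_nhdsGT (one_pos : (0 : ℝ) < 1)] with r hr using hbound r hr

/-- The excluded `μᵢ` are those with `μᵢ + 1` a pole of `Γ`, where `Real.Gamma` has the default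
value `0` and every `T^k δ_μ` would vanish. -/
theorem C_ne_zero {n : ℕ} {μ : Fin n → ℝ} (hμ : ∀ i, ∀ m : ℕ, μ i ≠ -((m : ℝ) + 1)) :
    C μ ≠ 0 := by
  refine Finset.prod_ne_zero_iff.2 fun i _ => mul_ne_zero (by positivity) ?_
  refine Real.Gamma_ne_zero fun m h => hμ i m ?_
  linarith

/-- A linear functional vanishing on the common kernel of finitely many others is a linear
combination of them. -/
theorem exists_eq_sum_of_forall_eq_zero {E ι : Type*} [AddCommMonoid E] [Module ℂ E]
    (s : Finset ι) (L : ι → E →ₗ[ℂ] ℂ) (K : E →ₗ[ℂ] ℂ)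
    (h : ∀ x, (∀ i ∈ s, L i x = 0) → K x = 0) :
    ∃ c : ι → ℂ, ∀ x, K x = ∑ i ∈ s, c i * L i x := by
  classical
  -- Negation is supplied by the scalar `-1`.
  let _ : AddCommGroup E := Module.addCommMonoidToAddCommGroup ℂ
  have hspan : K ∈ Submodule.span ℂ (Set.range fun i : s => L i) := by
    refine mem_span_of_iInf_ker_le_ker fun x hx => ?_
    simp only [Submodule.mem_iInf, LinearMap.mem_ker] at hx ⊢
    exact h x fun i hi => hx ⟨i, hi⟩
  obtain ⟨c, hc⟩ := (Submodule.mem_span_range_iff_exists_fun ℂ).1 hspan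
  refine ⟨fun i => if hi : i ∈ s then c ⟨i, hi⟩ else 0, fun x => ?_⟩
  rw [← hc, ← Finset.sum_coe_sort s]
  simp

end Zemanian

end

theorem mainTheorem4 {n : ℕ} (μ : Fin n → ℝ) (hμ : ∀ i, ∀ m : ℕ, μ i ≠ -((m : ℝ) + 1))
    (f : Zemanian.Dual μ)
    (hf : ∀ φ : Zemanian.H μ,
      (∃ a : ℝ, 0 < a ∧ Zemanian.supp φ ⊆ {x | x ∈ Zemanian.orthant n ∧ a ≤ ‖x‖}) → f φ = 0) :
    ∃ (N : ℕ) (c : (Fin n → ℕ) → ℂ),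
      f = ∑ k ∈ Zemanian.multiIndices n N, c k • Zemanian.Tdelta μ k := by
  obtain ⟨N, hN⟩ := Zemanian.exists_order f hf
  have hC : (Zemanian.C μ : ℂ) ≠ 0 := by exact_mod_cast Zemanian.C_ne_zero hμ
  -- As `C_μ ≠ 0`, the kernel of `TdeltaLin μ k` is that of the bare limit `limZero μ k`.
  obtain ⟨c, hc⟩ := Zemanian.exists_eq_sum_of_forall_eq_zero (Zemanian.multiIndices n N)
    (Zemanian.TdeltaLin μ) f.toLinearMap fun φ hφ => hN φ fun k hk =>
      (mul_eq_zero.1 (hφ k (Zemanian.mem_multiIndices.2 hk))).resolve_left hC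
  refine ⟨N, c, ContinuousLinearMap.ext fun φ => (hc φ).trans ?_⟩
  simp only [sum_apply, smul_apply]
  rfl
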